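/- Let $\mu>1$ and $z\in\mathbb R$. Let $\operatorname{arcsech}:(0,1]\to[0,\infty)$ be the inverse of $\operatorname{sech}=1/\cosh$ on $[0,\infty)$, and put $$x_1=z+\frac{1}{\sqrt{\mu-1}}\operatorname{arcsech}\sqrt{\frac{\mu+1}{2\mu}}.$$ There is exactly one $x_0\in\mathbb R$ with $$\tanh\frac{z-x_0}{\sqrt2}=\sqrt{\tfrac{2}{\mu+1}}\,\operatorname{sech}\big(\sqrt{\mu-1}\,(z-x_1)\big).$$ With this $x_0$ define $$u_0(x)=\begin{cases}\sqrt{\frac{2}{\mu+1}}\operatorname{sech}(\sqrt{\mu-1}(x-x_1)), & x\le z,\\ \tanh\frac{x-x_0}{\sqrt2}, & x>z,\end{cases}\qquad v_0(x)=\begin{cases}\sqrt{1-\frac{2\mu}{\mu+1}\operatorname{sech}^2(\sqrt{\mu-1}(x-x_1))}, & x\le z,\\ 0, & x>z.\end{cases}$$ Then: (i) $u_0\in C^2(\mathbb R)$, $v_0\in C(\mathbb R)$, and $(u_0,v_0)$ solves on $\mathbb R$ the system $$u''+u(1-u^2-\mu v^2)=0,\qquad v(1-v^2-\mu u^2)=0.$$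 (ii) $u_0$ is Lipschitz continuous on $\mathbb R$ and $v_0$ is Hölder continuous on $\mathbb R$ with exponent $\frac12$. (iii) Let $Y$ be the set of pairs $(u,v)\in H^1_{loc}(\mathbb R)\times C(\mathbb R)$ ($u$ being taken as its continuous representative) with $(u,v)\to(0,1)$ as $x\to-\infty$ and $(u,v)\to(1,0)$ as $x\to+\infty$, and let $$\tilde E(u,v)=\int_{-\infty}^{\infty}\frac{(u')^2}{2}+\frac14(u^2+v^2-1)^2+\frac{\mu-1}{2}u^2v^2\,dx\in[0,\infty].$$ Then $(u_0,v_0)\in Y$, $\tilde E(u_0,v_0)<\infty$, and $(u_0,v_0)$ minimizes $\tilde E$ over $Y$. Moreover it is the unique minimizer up to translation: $(u,v)\in Y$ minimizes $\tilde E$ over $Y$ if and only if there is $c\in\mathbb R$ with $u(x)=u_0(x-c)$ and $v(x)=v_0(x-c)$ for all $x\in\mathbb R$. -/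

import Mathlib

open MeasureTheory Filter Topology
open scoped ContDiff NNReal ENNReal

noncomputable section

namespace ThomasFermi

/-- `f ∈ L²_loc(ℝ)`. -/
def MemL2Loc (f : ℝ → ℝ) : Prop :=
  ∀ K : Set ℝ, IsCompact K → MemLp f 2 (volume.restrict K)

/-- `g` is a weak (distributional) derivative of `u` on `ℝ`; used for `u, g ∈ L²_loc(ℝ)`. -/
def HasWeakDeriv (u g : ℝ → ℝ) : Prop :=
  ∀ φ : ℝ → ℝ, ContDiff ℝ ∞ φ → HasCompactSupport φ →
    ∫ x, u x * deriv φ x = -∫ x, g x * φ x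

/-- `u ∈ H¹_loc(ℝ)`: both `u` and its weak derivative are locally square integrable. -/
def MemH1Loc (u : ℝ → ℝ) : Prop :=
  MemL2Loc u ∧ ∃ g : ℝ → ℝ, MemL2Loc g ∧ HasWeakDeriv u g

open Classical in
/-- The weak derivative of `u ∈ H¹_loc(ℝ)`, which is unique up to null sets. -/
def weakDeriv (u : ℝ → ℝ) : ℝ → ℝ :=
  if h : ∃ g : ℝ → ℝ, MemL2Loc g ∧ HasWeakDeriv u g then h.choose else 0

/-- The class `H¹_loc × C` with the conditions at infinity. As usual in dimension one, an element
of `H¹_loc(ℝ)` is identified with its continuous representative, so that its values and limits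
make sense. -/
structure Admissible (u v : ℝ → ℝ) : Prop where
  memH1Loc_u : MemH1Loc u
  continuous_u : Continuous u
  continuous_v : Continuous v
  u_atBot : Tendsto u atBot (𝓝 0)
  v_atBot : Tendsto v atBot (𝓝 1)
  u_atTop : Tendsto u atTop (𝓝 1)
  v_atTop : Tendsto v atTop (𝓝 0)

/-- The Thomas–Fermi energy, with values in `[0, ∞]`; its density is nonnegative for `μ ≥ 1`. -/
def energy (μ : ℝ) (u v : ℝ → ℝ) : ℝ≥0∞ :=
  ∫⁻ x, ENNReal.ofReal ((weakDeriv u x) ^ 2 / 2 + (u x ^ 2 + v x ^ 2 - 1) ^ 2 / 4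
    + (μ - 1) / 2 * (u x ^ 2 * v x ^ 2))

/-- `(u, v)` minimizes the Thomas–Fermi energy in the admissible class. -/
def IsMinimizer (μ : ℝ) (u v : ℝ → ℝ) : Prop :=
  Admissible u v ∧ ∀ u₁ v₁ : ℝ → ℝ, Admissible u₁ v₁ → energy μ u v ≤ energy μ u₁ v₁

/-- `(u, v)` is a classical solution of the system with `ε = 0`, on the whole line:
`u'' + u (1 - u² - μ v²) = 0` and `v (1 - v² - μ u²) = 0`, with `u` of class `C²` and `v`
continuous. -/
structure IsSolution (μ : ℝ) (u v : ℝ → ℝ) : Prop where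
  contDiff_u : ContDiff ℝ 2 u
  continuous_v : Continuous v
  eq_u : ∀ x, deriv (deriv u) x + u x * (1 - u x ^ 2 - μ * v x ^ 2) = 0
  eq_v : ∀ x, v x * (1 - v x ^ 2 - μ * u x ^ 2) = 0

/-- The hyperbolic secant. -/
def sech (x : ℝ) : ℝ := 1 / Real.cosh x

/-- The inverse `(0, 1] → [0, ∞)` of the hyperbolic secant. -/
def arcsech (y : ℝ) : ℝ := Real.arcosh (1 / y)

/-- The centre of the sech piece for the gluing point `z`. It lies to the right of `z`, which makes
the sech piece increasing on `(-∞, z]`. -/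
def x₁ (μ z : ℝ) : ℝ := z + 1 / √(μ - 1) * arcsech √((μ + 1) / (2 * μ))

/-- The equation for the centre `x₀` of the tanh piece: both pieces of `u₀` agree at `z`. -/
def IsMatching (μ z x₀ : ℝ) : Prop :=
  Real.tanh ((z - x₀) / √2) = √(2 / (μ + 1)) * sech (√(μ - 1) * (z - x₁ μ z))

/-- The first component of the explicit solution. -/
def u₀ (μ z x₀ : ℝ) (x : ℝ) : ℝ :=
  if x ≤ z then √(2 / (μ + 1)) * sech (√(μ - 1) * (x - x₁ μ z))
  else Real.tanh ((x - x₀) / √2)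

/-- The second component of the explicit solution. -/
def v₀ (μ z : ℝ) (x : ℝ) : ℝ :=
  if x ≤ z then √(1 - 2 * μ / (μ + 1) * sech (√(μ - 1) * (x - x₁ μ z)) ^ 2) else 0

end ThomasFermi

end

/-! ### Weak derivatives on the line and the chain rule for primitives -/

namespace ThomasFermi

/-! For fixed `u` in `[0, 1]`, minimizing the potential over `v` gives `v² = (1 - μ u²)⁺`, with
minimal value `s(u)² / 2`, where `s` is `speed μ`, extended by zero outside `[0, 1]`. Completing the
square, the energy density is `s(u) u'` plus the nonnegative quantity `(u' - s(u))² / 2 + (W(u, v) -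
s(u)² / 2)`, with `W` the potential. The first term is the derivative of `cost μ ∘ u`, so the
conditions at infinity fix its integral to be `cost μ 1` (`Admissible.energy_eq`). Hence the energy
is at least `cost μ 1`, with equality exactly when `u' = s(u)` and `v` is optimal at every point
(`Admissible.energy_eq_cost`, `Admissible.hasDerivAt_of_energy_le`).

The explicit pair satisfies this first-order system: the sech piece solves it below the level `1 /
√μ` and the tanh piece above it, and the two formulas for `s` agree at that level. Conversely, the
`u` of any minimizer solves `u' = s(u)` and takes the value `1 / √μ` somewhere. As `s` is Lipschitz,
ODE uniqueness makes it a translate of `u₀`. Then `v²` is determined, and the sign of `v` follows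
from `v → 1` at `-∞` and continuity (`IsMatching.exists_translate`). -/

theorem MemL2Loc.locallyIntegrable {f : ℝ → ℝ} (hf : MemL2Loc f) : LocallyIntegrable f := by
  rw [locallyIntegrable_iff]
  intro K hK
  have : IsFiniteMeasure (volume.restrict K) := ⟨by simpa using hK.measure_lt_top⟩
  exact (hf K hK).integrable (by norm_num)

theorem MemL2Loc.locallyIntegrable_sq {f : ℝ → ℝ} (hf : MemL2Loc f) :
    LocallyIntegrable (fun x => f x ^ 2) := by
  rw [locallyIntegrable_iff]
  intro K hK
  exact (hf K hK).integrable_sq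

theorem memL2Loc_of_continuous {f : ℝ → ℝ} (hf : Continuous f) : MemL2Loc f := by
  intro K hK
  have : IsFiniteMeasure (volume.restrict K) := ⟨by simpa using hK.measure_lt_top⟩
  obtain ⟨C, hC⟩ := hK.exists_bound_of_continuousOn hf.continuousOn
  exact MemLp.of_bound hf.aestronglyMeasurable C
    ((ae_restrict_iff' hK.measurableSet).2 (Eventually.of_forall hC))

theorem intervalIntegrable_of_locallyIntegrable {f : ℝ → ℝ} (hf : LocallyIntegrable f)
    (a b : ℝ) : IntervalIntegrable f volume a b :=
  intervalIntegrable_iff.mpr <|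
    (hf.integrableOn_isCompact isCompact_uIcc).mono_set Set.uIoc_subset_uIcc

/-- A compact subset of the line lies inside a bounded open interval. -/
theorem exists_subset_Ioo_of_isCompact {K : Set ℝ} (hK : IsCompact K) :
    ∃ a b : ℝ, a < b ∧ K ⊆ Set.Ioo a b := by
  obtain ⟨R, hR, h⟩ := hK.isBounded.subset_ball_lt 0 0
  refine ⟨-R, R, by linarith, ?_⟩
  simpa [Real.ball_eq_Ioo] using h

/-- Integration by parts of the primitive of a locally integrable function against a test
function. -/
theorem integral_primitive_mul_deriv {g φ : ℝ → ℝ} (hg : LocallyIntegrable g)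
    (hφ : ContDiff ℝ ∞ φ) (hφc : HasCompactSupport φ) (c : ℝ) :
    ∫ x, (∫ t in c..x, g t) * deriv φ x = -∫ x, g x * φ x := by
  -- The base point `c` is included so that the primitive is absolutely continuous on the same
  -- interval that carries the support of `φ`.
  obtain ⟨a, b, hab, hK⟩ := exists_subset_Ioo_of_isCompact
    (hφc.isCompact.union (isCompact_singleton (x := c)))
  have hc : c ∈ Set.uIcc a b := by
    rw [Set.uIcc_of_le hab.le]
    exact Set.Ioo_subset_Icc_self (hK (by simp))
  have hsupp : tsupport φ ⊆ Set.Ioo a b := Set.subset_union_left.trans hK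
  have hac := (intervalIntegrable_of_locallyIntegrable hg a b
    ).absolutelyContinuousOnInterval_intervalIntegral hc
  have hφac : AbsolutelyContinuousOnInterval φ a b :=
    (hφ.of_le (by simp)).contDiffOn.absolutelyContinuousOnInterval
  have hφ0 : ∀ x, x ∉ Set.Ioo a b → φ x = 0 := fun x hx =>
    image_eq_zero_of_notMem_tsupport fun h => hx (hsupp h)
  have key := hac.integral_mul_deriv_eq_deriv_mul hφac
  rw [hφ0 a (by simp), hφ0 b (by simp)] at key
  have e1 : ∫ x in a..b, deriv (fun x => ∫ t in c..x, g t) x * φ x = ∫ x in a..b, g x * φ x := by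
    apply intervalIntegral.integral_congr_ae
    filter_upwards [_root_.LocallyIntegrable.ae_hasDerivAt_integral hg] with x hx _
    rw [(hx c).deriv]
  rw [e1] at key
  have e2 : ∫ x in a..b, (∫ t in c..x, g t) * deriv φ x = ∫ x, (∫ t in c..x, g t) * deriv φ x := by
    apply intervalIntegral.integral_eq_integral_of_support_subset
    intro x hx
    have : x ∈ tsupport φ := by
      by_contra h
      apply hx
      have := support_deriv_subset (f := φ) (𝕜 := ℝ)
      have h2 : deriv φ x = 0 := by
        by_contra h3
        exact h (this h3)
      simp [h2]
    exact Set.Ioo_subset_Ioc_self (hsupp this)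
  have e3 : ∫ x in a..b, g x * φ x = ∫ x, g x * φ x := by
    apply intervalIntegral.integral_eq_integral_of_support_subset
    intro x hx
    have : x ∈ tsupport φ := by
      apply subset_tsupport
      intro h
      apply hx
      simp [h]
    exact Set.Ioo_subset_Ioc_self (hsupp this)
  rw [e2, e3] at key
  linarith

/-- A test function with zero integral is the derivative of a test function. -/
theorem exists_deriv_eq_of_integral_eq_zero {ψ : ℝ → ℝ} (hψ : ContDiff ℝ ∞ ψ)
    (hψc : HasCompactSupport ψ) (h0 : ∫ x, ψ x = 0) :
    ∃ φ : ℝ → ℝ, ContDiff ℝ ∞ φ ∧ HasCompactSupport φ ∧ deriv φ = ψ := by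
  obtain ⟨a, b, hab, hK⟩ := exists_subset_Ioo_of_isCompact hψc.isCompact
  have hψ0 : ∀ x, x ∉ Set.Ioo a b → ψ x = 0 := fun x hx =>
    image_eq_zero_of_notMem_tsupport fun h => hx (hK h)
  have hd : deriv (fun x => ∫ t in a..x, ψ t) = ψ := by
    ext x
    exact (hψ.continuous.integral_hasStrictDerivAt a x).hasDerivAt.deriv
  have hdiff : Differentiable ℝ (fun x => ∫ t in a..x, ψ t) := fun x =>
    (hψ.continuous.integral_hasStrictDerivAt a x).hasDerivAt.differentiableAt
  refine ⟨fun x => ∫ t in a..x, ψ t, ?_, ?_, hd⟩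
  · rw [contDiff_infty_iff_deriv, hd]
    exact ⟨hdiff, hψ⟩
  · refine HasCompactSupport.of_support_subset_isCompact (isCompact_Icc (a := a) (b := b)) ?_
    intro x hx
    by_contra h
    apply hx
    rw [Set.mem_Icc, not_and_or, not_le, not_le] at h
    rcases h with h | h
    · simp only
      rw [intervalIntegral.integral_congr (g := fun _ => 0)]
      · simp
      · intro t ht
        rw [Set.uIcc_of_ge h.le] at ht
        exact hψ0 t fun h' => absurd ht.2 (not_le.2 h'.1)
    · simp only
      rw [intervalIntegral.integral_eq_integral_of_support_subset, h0]
      intro t ht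
      have : t ∈ Set.Ioo a b := by
        by_contra h'
        exact ht (hψ0 t h')
      exact ⟨this.1, this.2.le.trans h.le⟩

/-- The lemma of du Bois-Reymond: a continuous function with zero distributional derivative is
constant. -/
theorem exists_eq_const_of_integral_mul_deriv_eq_zero {w : ℝ → ℝ} (hw : Continuous w)
    (h : ∀ φ : ℝ → ℝ, ContDiff ℝ ∞ φ → HasCompactSupport φ → ∫ x, w x * deriv φ x = 0) :
    ∃ c, ∀ x, w x = c := by
  let B : ContDiffBump (0 : ℝ) := default
  set ρ : ℝ → ℝ := B.normed volume with hρ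
  have hρs : ContDiff ℝ ∞ ρ := B.contDiff_normed
  have hρc : HasCompactSupport ρ := B.hasCompactSupport_normed
  have hρ1 : ∫ x, ρ x = 1 := B.integral_normed
  have int : ∀ f ψ : ℝ → ℝ, Continuous f → ContDiff ℝ ∞ ψ → HasCompactSupport ψ →
      Integrable (fun x => f x * ψ x) := fun f ψ hf hψ hψc =>
    (hf.mul hψ.continuous).integrable_of_hasCompactSupport hψc.mul_left
  set c := ∫ x, w x * ρ x with hc
  refine ⟨c, ?_⟩
  have hae : ∀ᵐ x, w x - c = 0 := by
    apply ae_eq_zero_of_integral_contDiff_smul_eq_zero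
    · exact (hw.sub continuous_const).locallyIntegrable
    intro ψ hψ hψc
    set m := ∫ x, ψ x with hm
    have iψ : Integrable ψ := hψ.continuous.integrable_of_hasCompactSupport hψc
    have iρ : Integrable ρ := hρs.continuous.integrable_of_hasCompactSupport hρc
    -- Subtracting `m * ρ`, where `ρ` has mass one, makes the integral vanish, so the difference is
    -- an admissible derivative.
    obtain ⟨φ, hφ, hφc, hφd⟩ := exists_deriv_eq_of_integral_eq_zero
      (ψ := fun x => ψ x - m * ρ x) (hψ.sub (contDiff_const.mul hρs))
      (hψc.sub hρc.mul_left) (by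
        rw [integral_sub iψ (iρ.const_mul m), integral_const_mul, hρ1, ← hm]; ring)
    have h1 := h φ hφ hφc
    rw [hφd] at h1
    have e : ∀ x, w x * (ψ x - m * ρ x) = w x * ψ x - m * (w x * ρ x) := fun x => by ring
    simp only [e] at h1
    rw [integral_sub (int w ψ hw hψ hψc) ((int w ρ hw hρs hρc).const_mul m),
      integral_const_mul, ← hc] at h1
    have e2 : ∀ x, ψ x • (w x - c) = w x * ψ x - c * ψ x := fun x => by
      simp only [smul_eq_mul]; ring
    simp only [e2]
    rw [integral_sub (int w ψ hw hψ hψc) (iψ.const_mul c), integral_const_mul, ← hm]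
    linarith
  have heq : (fun x => w x - c) = fun _ => 0 :=
    Continuous.ae_eq_iff_eq (μ := volume) (hw.sub continuous_const) continuous_const |>.1 hae
  intro x
  exact sub_eq_zero.1 (congrFun heq x)

/-- A continuous function is the primitive of its weak derivative. -/
theorem HasWeakDeriv.sub_eq_integral {u g : ℝ → ℝ} (hu : Continuous u)
    (hg : LocallyIntegrable g) (h : HasWeakDeriv u g) (a b : ℝ) :
    u b - u a = ∫ x in a..b, g x := by
  have hprim : Continuous fun x => ∫ t in (0 : ℝ)..x, g t :=
    intervalIntegral.continuous_primitive (intervalIntegrable_of_locallyIntegrable hg) 0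
  obtain ⟨c, hc⟩ := exists_eq_const_of_integral_mul_deriv_eq_zero
    (w := fun x => u x - ∫ t in (0 : ℝ)..x, g t) (hu.sub hprim) (by
    intro φ hφ hφc
    have hdc : HasCompactSupport (deriv φ) := hφc.deriv
    have hd : Continuous (deriv φ) := hφ.continuous_deriv (by simp)
    have e : ∀ x, (u x - ∫ t in (0 : ℝ)..x, g t) * deriv φ x
      = u x * deriv φ x - (∫ t in (0 : ℝ)..x, g t) * deriv φ x := fun x => by ring
    have iu : Integrable fun x => u x * deriv φ x :=
      (hu.mul hd).integrable_of_hasCompactSupport hdc.mul_left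
    have ip : Integrable fun x => (∫ t in (0 : ℝ)..x, g t) * deriv φ x :=
      (hprim.mul hd).integrable_of_hasCompactSupport hdc.mul_left
    simp only [e]
    rw [integral_sub iu ip, integral_primitive_mul_deriv hg hφ hφc, h φ hφ hφc, sub_self])
  have ha := hc a
  have hb := hc b
  rw [← intervalIntegral.integral_interval_sub_left
    (intervalIntegrable_of_locallyIntegrable hg 0 b)
    (intervalIntegrable_of_locallyIntegrable hg 0 a)]
  linarith

/-- The classical derivative of a `C¹` function is a weak derivative. -/
theorem hasWeakDeriv_of_hasDerivAt {u g : ℝ → ℝ} (hg : Continuous g)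
    (h : ∀ x, HasDerivAt u (g x) x) : HasWeakDeriv u g := by
  intro φ hφ hφc
  have hu : Continuous u := continuous_iff_continuousAt.2 fun x => (h x).continuousAt
  have hd : Continuous (deriv φ) := hφ.continuous_deriv (by simp)
  exact integral_mul_deriv_eq_deriv_mul_of_integrable (fun x _ => h x)
    (fun x _ => ((hφ.differentiable (by simp)) x).hasDerivAt)
    ((hu.mul hd).integrable_of_hasCompactSupport hφc.deriv.mul_left)
    ((hg.mul hφ.continuous).integrable_of_hasCompactSupport hφc.mul_left)
    ((hu.mul hφ.continuous).integrable_of_hasCompactSupport hφc.mul_left)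

theorem HasWeakDeriv.ae_eq {u g₁ g₂ : ℝ → ℝ} (hg₁ : LocallyIntegrable g₁)
    (hg₂ : LocallyIntegrable g₂) (h₁ : HasWeakDeriv u g₁) (h₂ : HasWeakDeriv u g₂) :
    g₁ =ᵐ[volume] g₂ := by
  apply ae_eq_of_integral_contDiff_smul_eq hg₁ hg₂
  intro φ hφ hφc
  have := (h₁ φ hφ hφc).symm.trans (h₂ φ hφ hφc)
  simp only [smul_eq_mul, mul_comm (φ _)]
  linarith

theorem MemH1Loc.memL2Loc_weakDeriv {u : ℝ → ℝ} (hu : MemH1Loc u) : MemL2Loc (weakDeriv u) := by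
  rw [weakDeriv, dif_pos hu.2]
  exact hu.2.choose_spec.1

theorem MemH1Loc.hasWeakDeriv {u : ℝ → ℝ} (hu : MemH1Loc u) : HasWeakDeriv u (weakDeriv u) := by
  rw [weakDeriv, dif_pos hu.2]
  exact hu.2.choose_spec.2

theorem memH1Loc_of_hasDerivAt {u g : ℝ → ℝ} (hg : Continuous g)
    (h : ∀ x, HasDerivAt u (g x) x) : MemH1Loc u :=
  ⟨memL2Loc_of_continuous (continuous_iff_continuousAt.2 fun x => (h x).continuousAt),
    g, memL2Loc_of_continuous hg, hasWeakDeriv_of_hasDerivAt hg h⟩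

/-- `weakDeriv` is an arbitrary choice among weak derivatives, so only almost everywhere equality
can be expected. -/
theorem weakDeriv_ae_eq {u g : ℝ → ℝ} (hg : Continuous g)
    (h : ∀ x, HasDerivAt u (g x) x) : weakDeriv u =ᵐ[volume] g :=
  have hu := memH1Loc_of_hasDerivAt hg h
  hu.hasWeakDeriv.ae_eq hu.memL2Loc_weakDeriv.locallyIntegrable hg.locallyIntegrable
    (hasWeakDeriv_of_hasDerivAt hg h)

/-- Post-composition with a Lipschitz function preserves absolute continuity. -/
theorem _root_.LipschitzWith.comp_absolutelyContinuousOnInterval {H u : ℝ → ℝ} {K : ℝ≥0}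
    {a b : ℝ} (hH : LipschitzWith K H) (hu : AbsolutelyContinuousOnInterval u a b) :
    AbsolutelyContinuousOnInterval (fun x => H (u x)) a b := by
  unfold AbsolutelyContinuousOnInterval at hu ⊢
  have := hu.const_mul (K : ℝ)
  rw [mul_zero] at this
  refine squeeze_zero (fun _ => Finset.sum_nonneg fun _ _ => dist_nonneg) (fun E => ?_) this
  rw [Finset.mul_sum]
  exact Finset.sum_le_sum fun i _ => hH.dist_le_mul _ _

/-- The chain rule for a primitive `H` with bounded derivative and an absolutely continuous
function. -/
theorem integral_comp_mul_eq_sub {G H u g : ℝ → ℝ} {K : ℝ≥0} (hH : LipschitzWith K H)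
    (hHd : ∀ y, HasDerivAt H (G y) y) (hg : LocallyIntegrable g)
    (hu : ∀ a b, u b - u a = ∫ x in a..b, g x) (a b : ℝ) :
    ∫ x in a..b, G (u x) * g x = H (u b) - H (u a) := by
  have hu' : u = fun x => u a + ∫ t in a..x, g t := by
    ext x
    rw [← hu]; ring
  have hprim := (intervalIntegrable_of_locallyIntegrable hg a b
    ).absolutelyContinuousOnInterval_intervalIntegral (c := a) (by simp)
  have hac : AbsolutelyContinuousOnInterval u a b := by
    rw [hu']
    exact ((LipschitzWith.const (u a)).lipschitzOnWith.absolutelyContinuousOnInterval).add hprim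
  -- `H ∘ u` is absolutely continuous, so it is the integral of its almost everywhere derivative.
  rw [← (hH.comp_absolutelyContinuousOnInterval hac).integral_deriv_eq_sub]
  apply intervalIntegral.integral_congr_ae
  filter_upwards [_root_.LocallyIntegrable.ae_hasDerivAt_integral hg] with x hx _
  have h1 : HasDerivAt u (g x) x := by
    rw [hu']
    exact (hx a).const_add (u a)
  exact ((hHd (u x)).comp x h1).deriv.symm

end ThomasFermi

/-! ### The optimal potential, the speed and the cost -/

noncomputable section

namespace ThomasFermi

/-- The potential energy density. -/
def potential (μ u v : ℝ) : ℝ := (u ^ 2 + v ^ 2 - 1) ^ 2 / 4 + (μ - 1) / 2 * (u ^ 2 * v ^ 2)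

/-- The speed of the transition on the range `[0, 1 / √μ]` of the coexistence phase. -/
def speedLeft (μ y : ℝ) : ℝ := √(μ - 1) * y * √(1 - (μ + 1) / 2 * y ^ 2)

/-- The speed of the transition on the range `[1 / √μ, 1]` of the pure phase. -/
def speedRight (y : ℝ) : ℝ := (1 - y ^ 2) / √2

/-- The speed `√(2 min_v potential)` of the transition at level `y`, extended by zero outside
`[0, 1]`. -/
def speed (μ y : ℝ) : ℝ :=
  speedLeft μ (max 0 (min y (√μ)⁻¹)) + speedRight (max (√μ)⁻¹ (min y 1)) - speedRight (√μ)⁻¹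

/-- The primitive of the speed. -/
def cost (μ y : ℝ) : ℝ := ∫ t in (0 : ℝ)..y, speed μ t

variable {μ : ℝ}

theorem inv_sqrt_sq (hμ : 1 < μ) : ((√μ)⁻¹) ^ 2 = 1 / μ := by
  rw [inv_pow, Real.sq_sqrt (by linarith), one_div]

theorem inv_sqrt_pos (hμ : 1 < μ) : 0 < (√μ)⁻¹ := by
  have := Real.sqrt_pos.2 (by linarith : 0 < μ)
  positivity

theorem inv_sqrt_lt_one (hμ : 1 < μ) : (√μ)⁻¹ < 1 := by
  have h := inv_sqrt_sq hμ
  have : 1 / μ < 1 := by rw [div_lt_one (by linarith)]; exact hμ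
  have := inv_sqrt_pos hμ
  nlinarith

theorem mul_sq_le_one_of_le (hμ : 1 < μ) {y : ℝ} (h0 : 0 ≤ y) (h : y ≤ (√μ)⁻¹) :
    μ * y ^ 2 ≤ 1 := by
  have h1 : y ^ 2 ≤ 1 / μ := by rw [← inv_sqrt_sq hμ]; gcongr
  rw [le_div_iff₀ (by linarith)] at h1
  linarith

theorem one_le_mul_sq_of_le (hμ : 1 < μ) {y : ℝ} (h : (√μ)⁻¹ ≤ y) : 1 ≤ μ * y ^ 2 := by
  have h1 : 1 / μ ≤ y ^ 2 := by
    rw [← inv_sqrt_sq hμ]; have := inv_sqrt_pos hμ; gcongr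
  rw [div_le_iff₀ (by linarith)] at h1
  linarith

theorem speedLeft_radicand_pos (hμ : 1 < μ) {y : ℝ} (h : μ * y ^ 2 ≤ 1) :
    0 < 1 - (μ + 1) / 2 * y ^ 2 := by
  nlinarith [sq_nonneg y]

theorem speedLeft_sq (hμ : 1 < μ) {y : ℝ} (h : μ * y ^ 2 ≤ 1) :
    speedLeft μ y ^ 2 = (μ - 1) * y ^ 2 * (1 - (μ + 1) / 2 * y ^ 2) := by
  rw [speedLeft, mul_pow, mul_pow, Real.sq_sqrt (by linarith),
    Real.sq_sqrt (speedLeft_radicand_pos hμ h).le]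

theorem speedRight_sq (y : ℝ) : speedRight y ^ 2 = (1 - y ^ 2) ^ 2 / 2 := by
  rw [speedRight, div_pow, Real.sq_sqrt (by norm_num)]

theorem speedLeft_nonneg {y : ℝ} (h : 0 ≤ y) : 0 ≤ speedLeft μ y := by
  unfold speedLeft; positivity

theorem speedRight_nonneg {y : ℝ} (h0 : 0 ≤ y) (h : y ≤ 1) : 0 ≤ speedRight y :=
  div_nonneg (by nlinarith) (Real.sqrt_nonneg _)

/-- Both squares equal `(1 - 1 / μ)² / 2`. This makes `speed` continuous and `u₀` differentiable at
the gluing point. -/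
theorem speedLeft_inv_sqrt (hμ : 1 < μ) : speedLeft μ (√μ)⁻¹ = speedRight (√μ)⁻¹ := by
  have h0 := inv_sqrt_pos hμ
  rw [← sq_eq_sq₀ (speedLeft_nonneg h0.le)
    (speedRight_nonneg h0.le (inv_sqrt_lt_one hμ).le), speedRight_sq,
    speedLeft_sq hμ (mul_sq_le_one_of_le hμ h0.le le_rfl), inv_sqrt_sq hμ]
  have : μ ≠ 0 := by positivity
  field_simp
  ring

/-- Clamping freezes the other summand at its value at the junction, and the subtracted constant
cancels it. -/
theorem speed_eq_speedLeft (hμ : 1 < μ) {y : ℝ} (h0 : 0 ≤ y) (h : y ≤ (√μ)⁻¹) :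
    speed μ y = speedLeft μ y := by
  have h1 := inv_sqrt_lt_one hμ
  rw [speed, min_eq_left h, max_eq_right h0, min_eq_left (by linarith), max_eq_left h]
  ring

theorem speed_eq_speedRight (hμ : 1 < μ) {y : ℝ} (h : (√μ)⁻¹ ≤ y) (h1 : y ≤ 1) :
    speed μ y = speedRight y := by
  rw [speed, min_eq_right h, max_eq_right (inv_sqrt_pos hμ).le, min_eq_left h1, max_eq_right h,
    speedLeft_inv_sqrt hμ]
  ring

theorem speed_of_nonpos (hμ : 1 < μ) {y : ℝ} (h : y ≤ 0) : speed μ y = 0 := by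
  have h0 := inv_sqrt_pos hμ
  have h1 := inv_sqrt_lt_one hμ
  rw [speed, min_eq_left (by linarith), max_eq_left h, min_eq_left (by linarith),
    max_eq_left (by linarith)]
  simp [speedLeft]

theorem speed_of_one_le (hμ : 1 < μ) {y : ℝ} (h : 1 ≤ y) : speed μ y = 0 := by
  have h0 := inv_sqrt_pos hμ
  have h1 := inv_sqrt_lt_one hμ
  rw [speed, min_eq_right (by linarith), max_eq_right h0.le, min_eq_right h,
    max_eq_right h1.le, speedLeft_inv_sqrt hμ]
  simp [speedRight]

theorem speed_nonneg (hμ : 1 < μ) (y : ℝ) : 0 ≤ speed μ y := by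
  rcases le_total y 0 with h | h
  · exact (speed_of_nonpos hμ h).ge
  rcases le_total 1 y with h1 | h1
  · exact (speed_of_one_le hμ h1).ge
  rcases le_total y (√μ)⁻¹ with h2 | h2
  · rw [speed_eq_speedLeft hμ h h2]; exact speedLeft_nonneg h
  · rw [speed_eq_speedRight hμ h2 h1]; exact speedRight_nonneg h h1

theorem potential_nonneg (hμ : 1 < μ) (u v : ℝ) : 0 ≤ potential μ u v := by
  have : 0 < μ - 1 := by linarith
  unfold potential
  positivity

/-- The potential is quadratic in `v²`; this completes the square, the vertex `1 - μ u²` being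
nonnegative on this range. -/
theorem potential_sub_speed_sq_left (hμ : 1 < μ) {u : ℝ} (h0 : 0 ≤ u) (h : u ≤ (√μ)⁻¹)
    (v : ℝ) : potential μ u v - speed μ u ^ 2 / 2 = (v ^ 2 - (1 - μ * u ^ 2)) ^ 2 / 4 := by
  rw [speed_eq_speedLeft hμ h0 h, speedLeft_sq hμ (mul_sq_le_one_of_le hμ h0 h), potential]
  ring

/-- Here the vertex `1 - μ u²` is nonpositive, so the minimum over `v² ≥ 0` sits at `v = 0`, and
both terms are nonnegative. -/
theorem potential_sub_speed_sq_right (hμ : 1 < μ) {u : ℝ} (h : (√μ)⁻¹ ≤ u) (h1 : u ≤ 1)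
    (v : ℝ) : potential μ u v - speed μ u ^ 2 / 2
      = v ^ 4 / 4 + v ^ 2 * (μ * u ^ 2 - 1) / 2 := by
  rw [speed_eq_speedRight hμ h h1, speedRight_sq, potential]
  ring

theorem speed_sq_le_potential (hμ : 1 < μ) (u v : ℝ) : speed μ u ^ 2 / 2 ≤ potential μ u v := by
  rcases le_total u 0 with h | h
  · rw [speed_of_nonpos hμ h]; simpa using potential_nonneg hμ u v
  rcases le_total 1 u with h1 | h1
  · rw [speed_of_one_le hμ h1]; simpa using potential_nonneg hμ u v
  rw [← sub_nonneg]
  rcases le_total u (√μ)⁻¹ with h2 | h2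
  · rw [potential_sub_speed_sq_left hμ h h2]; positivity
  · rw [potential_sub_speed_sq_right hμ h2 h1]
    have := one_le_mul_sq_of_le hμ h2
    have : 0 ≤ μ * u ^ 2 - 1 := by linarith
    positivity

/-- On `[0, 1]` the potential is minimal exactly for `v ^ 2 = (1 - μ u ^ 2)⁺`. -/
theorem potential_eq_speed_sq_iff (hμ : 1 < μ) {u v : ℝ} (h : 0 ≤ u) (h1 : u ≤ 1) :
    potential μ u v = speed μ u ^ 2 / 2 ↔ v ^ 2 = max (1 - μ * u ^ 2) 0 := by
  rw [← sub_eq_zero]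
  rcases le_total u (√μ)⁻¹ with h2 | h2
  · rw [potential_sub_speed_sq_left hμ h h2,
      max_eq_left (by linarith [mul_sq_le_one_of_le hμ h h2])]
    constructor
    · intro h3
      have : (v ^ 2 - (1 - μ * u ^ 2)) ^ 2 = 0 := by linarith
      exact sub_eq_zero.1 (pow_eq_zero_iff (by norm_num) |>.1 this)
    · intro h3
      rw [h3]; simp
  · have h4 := one_le_mul_sq_of_le hμ h2
    rw [potential_sub_speed_sq_right hμ h2 h1, max_eq_right (by linarith)]
    constructor
    · intro h3
      have : 0 ≤ v ^ 2 * (μ * u ^ 2 - 1) := mul_nonneg (sq_nonneg v) (by linarith)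
      nlinarith [sq_nonneg v, sq_nonneg (v ^ 2)]
    · intro h3
      have : v ^ 4 = (v ^ 2) ^ 2 := by ring
      rw [this, h3]; ring

/-- On `[0, 1]`, comparison with the potential at `v = 0`, which is at most `1 / 4`, even gives
`speed² ≤ 1 / 2`. -/
theorem speed_le_one (hμ : 1 < μ) (y : ℝ) : speed μ y ≤ 1 := by
  rcases le_total y 0 with h | h
  · rw [speed_of_nonpos hμ h]; norm_num
  rcases le_total 1 y with h1 | h1
  · rw [speed_of_one_le hμ h1]; norm_num
  have h2 := speed_sq_le_potential hμ y 0
  have h3 := speed_nonneg hμ y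
  have h4 : potential μ y 0 ≤ 1 / 4 := by
    have : y ^ 2 ≤ 1 := by nlinarith
    unfold potential; nlinarith [sq_nonneg y]
  nlinarith

theorem speed_pos (hμ : 1 < μ) {y : ℝ} (h : 0 < y) (h1 : y < 1) : 0 < speed μ y := by
  have hm : 0 < μ - 1 := by linarith
  rcases le_total y (√μ)⁻¹ with h2 | h2
  · rw [speed_eq_speedLeft hμ h.le h2]
    have := speedLeft_radicand_pos hμ (mul_sq_le_one_of_le hμ h.le h2)
    unfold speedLeft; positivity
  · rw [speed_eq_speedRight hμ h2 h1.le]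
    exact div_pos (by nlinarith) (by positivity)

/-- The radicand stays positive up to `1 / √μ`, so each branch is `C¹` on its compact interval, and
the clamps are 1-Lipschitz. This global bound is what ODE uniqueness needs. -/
theorem exists_lipschitzWith_speed (hμ : 1 < μ) : ∃ K : ℝ≥0, LipschitzWith K (speed μ) := by
  have h0 := inv_sqrt_pos hμ
  obtain ⟨K₁, hK₁⟩ : ∃ K, LipschitzOnWith K (speedLeft μ) (Set.Icc 0 (√μ)⁻¹) := by
    refine ContDiffOn.exists_lipschitzOnWith (n := 1) ?_ one_ne_zero (convex_Icc _ _) isCompact_Icc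
    intro y hy
    have hpos := speedLeft_radicand_pos hμ (mul_sq_le_one_of_le hμ hy.1 hy.2)
    refine ContDiffAt.contDiffWithinAt ?_
    unfold speedLeft
    exact (contDiffAt_const.mul contDiffAt_id).mul
      ((contDiffAt_const.sub (contDiffAt_const.mul (contDiffAt_id.pow 2))).sqrt hpos.ne')
  obtain ⟨K₂, hK₂⟩ : ∃ K, LipschitzOnWith K speedRight (Set.Icc (√μ)⁻¹ 1) := by
    refine ContDiffOn.exists_lipschitzOnWith (n := 1) ?_ one_ne_zero (convex_Icc _ _) isCompact_Icc
    apply ContDiff.contDiffOn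
    unfold speedRight
    fun_prop
  have c₁ : LipschitzWith 1 fun y : ℝ => max 0 (min y (√μ)⁻¹) :=
    (LipschitzWith.id.min_const _).const_max 0
  have c₂ : LipschitzWith 1 fun y : ℝ => max (√μ)⁻¹ (min y 1) :=
    (LipschitzWith.id.min_const _).const_max _
  have l₁ : LipschitzWith (K₁ * 1) fun y => speedLeft μ (max 0 (min y (√μ)⁻¹)) :=
    lipschitzOnWith_univ.1 (hK₁.comp c₁.lipschitzOnWith
      fun y _ => ⟨le_max_left _ _, max_le h0.le (min_le_right _ _)⟩)
  have l₂ : LipschitzWith (K₂ * 1) fun y => speedRight (max (√μ)⁻¹ (min y 1)) :=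
    lipschitzOnWith_univ.1 (hK₂.comp c₂.lipschitzOnWith
      fun y _ => ⟨le_max_left _ _, max_le (inv_sqrt_lt_one hμ).le (min_le_right _ _)⟩)
  exact ⟨_, (l₁.add l₂).sub (LipschitzWith.const (speedRight (√μ)⁻¹))⟩

theorem continuous_speed (hμ : 1 < μ) : Continuous (speed μ) :=
  (exists_lipschitzWith_speed hμ).choose_spec.continuous

theorem hasDerivAt_cost (hμ : 1 < μ) (y : ℝ) : HasDerivAt (cost μ) (speed μ y) y :=
  ((continuous_speed hμ).integral_hasStrictDerivAt 0 y).hasDerivAt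

theorem lipschitzWith_cost (hμ : 1 < μ) : LipschitzWith 1 (cost μ) := by
  refine lipschitzWith_of_nnnorm_deriv_le (𝕜 := ℝ)
    (fun y => (hasDerivAt_cost hμ y).differentiableAt) fun y => ?_
  rw [(hasDerivAt_cost hμ y).deriv, ← NNReal.coe_le_coe, coe_nnnorm, Real.norm_eq_abs,
    abs_of_nonneg (speed_nonneg hμ y)]
  exact speed_le_one hμ y

theorem cost_zero : cost μ 0 = 0 := by simp [cost]

theorem cost_one_pos (hμ : 1 < μ) : 0 < cost μ 1 :=
  intervalIntegral.intervalIntegral_pos_of_pos_on ((continuous_speed hμ).intervalIntegrable 0 1)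
    (fun _ hy => speed_pos hμ hy.1 hy.2) one_pos

/-! ### The lower bound for the energy and its equality case -/

/-- The excess of the energy density over its lower bound `(cost μ ∘ u)'`. -/
def excess (μ : ℝ) (u v : ℝ → ℝ) (x : ℝ) : ℝ :=
  (weakDeriv u x - speed μ (u x)) ^ 2 / 2 + (potential μ (u x) (v x) - speed μ (u x) ^ 2 / 2)

theorem excess_nonneg (hμ : 1 < μ) (u v : ℝ → ℝ) (x : ℝ) : 0 ≤ excess μ u v x := by
  have := speed_sq_le_potential hμ (u x) (v x)
  have := sq_nonneg (weakDeriv u x - speed μ (u x))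
  unfold excess
  linarith

theorem Admissible.continuous_speed_comp {u v : ℝ → ℝ} (h : Admissible u v) (hμ : 1 < μ) :
    Continuous fun x => speed μ (u x) := (continuous_speed hμ).comp h.continuous_u

theorem Admissible.continuous_potential_comp {u v : ℝ → ℝ} (h : Admissible u v) (μ : ℝ) :
    Continuous fun x => potential μ (u x) (v x) := by
  have := h.continuous_u
  have := h.continuous_v
  unfold potential
  fun_prop

theorem Admissible.locallyIntegrable_speed_mul {u v : ℝ → ℝ} (h : Admissible u v) (hμ : 1 < μ) :
    LocallyIntegrable fun x => speed μ (u x) * weakDeriv u x := by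
  rw [locallyIntegrable_iff]
  intro K hK
  exact (h.memH1Loc_u.memL2Loc_weakDeriv.locallyIntegrable.integrableOn_isCompact hK
    ).continuousOn_mul (h.continuous_speed_comp hμ).continuousOn hK

theorem Admissible.locallyIntegrable_excess {u v : ℝ → ℝ} (h : Admissible u v) (hμ : 1 < μ) :
    LocallyIntegrable (excess μ u v) := by
  have h1 := h.memH1Loc_u.memL2Loc_weakDeriv.locallyIntegrable_sq.smul (2⁻¹ : ℝ)
  have h2 := h.locallyIntegrable_speed_mul hμ
  have h3 := (h.continuous_potential_comp μ).locallyIntegrable (μ := volume)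
  have : excess μ u v = fun x => (2⁻¹ : ℝ) • (weakDeriv u x ^ 2)
      - speed μ (u x) * weakDeriv u x + potential μ (u x) (v x) := by
    ext x
    simp only [excess, smul_eq_mul]
    ring
  rw [this]
  exact (h1.sub h2).add h3

/-- The energy is the cost of the transition plus the integral of the excess. -/
theorem Admissible.energy_eq {u v : ℝ → ℝ} (h : Admissible u v) (hμ : 1 < μ) :
    energy μ u v = ENNReal.ofReal (cost μ 1) + ∫⁻ x, ENNReal.ofReal (excess μ u v x) := by
  have hg := h.memH1Loc_u.memL2Loc_weakDeriv.locallyIntegrable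
  have hsm := h.locallyIntegrable_speed_mul hμ
  have hex := h.locallyIntegrable_excess hμ
  have hmeas : AEMeasurable (fun x => ENNReal.ofReal (excess μ u v x)) :=
    hex.aestronglyMeasurable.aemeasurable.ennreal_ofReal
  have hdens : ∀ x, (weakDeriv u x) ^ 2 / 2 + (u x ^ 2 + v x ^ 2 - 1) ^ 2 / 4
      + (μ - 1) / 2 * (u x ^ 2 * v x ^ 2)
      = speed μ (u x) * weakDeriv u x + excess μ u v x := by
    intro x
    simp only [excess, potential]
    ring
  have hnn : ∀ x, 0 ≤ speed μ (u x) * weakDeriv u x + excess μ u v x := by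
    intro x
    rw [← hdens]
    have : 0 < μ - 1 := by linarith
    positivity
  unfold energy
  simp only [hdens]
  -- Integrability of `speed * u'` on the whole line is not assumed, so the identity is proved on
  -- `(-n, n]` and passed to the limit.
  have hcov : AECover volume atTop fun n : ℕ => Set.Ioc (-(n : ℝ)) n :=
    aecover_Ioc (tendsto_neg_atTop_atBot.comp tendsto_natCast_atTop_atTop)
      tendsto_natCast_atTop_atTop
  have hdiff : Tendsto (fun n : ℕ => cost μ (u n) - cost μ (u (-(n : ℝ)))) atTop
      (𝓝 (cost μ 1)) := by
    have hc : Continuous (cost μ) := (lipschitzWith_cost hμ).continuous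
    have t1 := (hc.tendsto 1).comp (h.u_atTop.comp tendsto_natCast_atTop_atTop)
    have t2 := (hc.tendsto 0).comp (h.u_atBot.comp
      (tendsto_neg_atTop_atBot.comp (tendsto_natCast_atTop_atTop (R := ℝ))))
    simpa [cost_zero] using t1.sub t2
  refine hcov.lintegral_eq_of_tendsto _
    (hsm.add hex).aestronglyMeasurable.aemeasurable.ennreal_ofReal ?_
  refine Tendsto.congr' ?_ ((ENNReal.tendsto_ofReal hdiff).add
    (hcov.lintegral_tendsto_of_countably_generated hmeas))
  -- Since `cost μ 1 > 0`, the boundary term is eventually positive, as splitting `ENNReal.ofReal`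
  -- over the sum requires.
  filter_upwards [hdiff.eventually (lt_mem_nhds (cost_one_pos hμ))] with n hn
  have hle : -(n : ℝ) ≤ n := by linarith [n.cast_nonneg (α := ℝ)]
  have hi1 := intervalIntegrable_of_locallyIntegrable hsm (-(n : ℝ)) n
  have hi2 := intervalIntegrable_of_locallyIntegrable hex (-(n : ℝ)) n
  rw [← ofReal_integral_eq_lintegral_ofReal ((intervalIntegrable_iff_integrableOn_Ioc_of_le hle).1
      hi2) (Eventually.of_forall (excess_nonneg hμ u v)),
    ← ofReal_integral_eq_lintegral_ofReal ((intervalIntegrable_iff_integrableOn_Ioc_of_le hle).1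
      (hi1.add hi2)) (Eventually.of_forall hnn),
    ← intervalIntegral.integral_of_le hle, ← intervalIntegral.integral_of_le hle,
    ← ENNReal.ofReal_add hn.le
      (intervalIntegral.integral_nonneg hle fun x _ => excess_nonneg hμ u v x),
    intervalIntegral.integral_add hi1 hi2,
    integral_comp_mul_eq_sub (lipschitzWith_cost hμ) (hasDerivAt_cost hμ) hg
      (h.memH1Loc_u.hasWeakDeriv.sub_eq_integral h.continuous_u hg)]

theorem Admissible.le_energy {u v : ℝ → ℝ} (h : Admissible u v) (hμ : 1 < μ) :
    ENNReal.ofReal (cost μ 1) ≤ energy μ u v := by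
  rw [h.energy_eq hμ]; exact le_self_add

/-- Equality in the lower bound for a solution of the first-order system. -/
theorem Admissible.energy_eq_cost {u v : ℝ → ℝ} (h : Admissible u v) (hμ : 1 < μ)
    (hd : ∀ x, HasDerivAt u (speed μ (u x)) x)
    (hp : ∀ x, potential μ (u x) (v x) = speed μ (u x) ^ 2 / 2) :
    energy μ u v = ENNReal.ofReal (cost μ 1) := by
  rw [h.energy_eq hμ]
  convert add_zero _
  rw [lintegral_eq_zero_iff' (h.locallyIntegrable_excess hμ
    ).aestronglyMeasurable.aemeasurable.ennreal_ofReal]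
  filter_upwards [weakDeriv_ae_eq (h.continuous_speed_comp hμ) hd] with x hx
  simp [excess, hx, hp]

/-- Conversely, equality in the lower bound forces the first-order system. -/
theorem Admissible.hasDerivAt_of_energy_le {u v : ℝ → ℝ} (h : Admissible u v) (hμ : 1 < μ)
    (he : energy μ u v ≤ ENNReal.ofReal (cost μ 1)) :
    (∀ x, HasDerivAt u (speed μ (u x)) x) ∧
      ∀ x, potential μ (u x) (v x) = speed μ (u x) ^ 2 / 2 := by
  have hg := h.memH1Loc_u.memL2Loc_weakDeriv.locallyIntegrable
  have hs := h.continuous_speed_comp hμ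
  rw [h.energy_eq hμ] at he
  have h0 : ∫⁻ x, ENNReal.ofReal (excess μ u v x) = 0 := by
    have h1 : ENNReal.ofReal (cost μ 1) + ∫⁻ x, ENNReal.ofReal (excess μ u v x)
        ≤ ENNReal.ofReal (cost μ 1) + 0 := by simpa using he
    exact le_zero_iff.1 ((ENNReal.add_le_add_iff_left ENNReal.ofReal_ne_top).1 h1)
  rw [lintegral_eq_zero_iff' (h.locallyIntegrable_excess hμ
    ).aestronglyMeasurable.aemeasurable.ennreal_ofReal] at h0
  have hae : ∀ᵐ x, weakDeriv u x = speed μ (u x) ∧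
      potential μ (u x) (v x) = speed μ (u x) ^ 2 / 2 := by
    filter_upwards [h0] with x hx
    have hx' : excess μ u v x ≤ 0 := ENNReal.ofReal_eq_zero.1 hx
    have h1 := speed_sq_le_potential hμ (u x) (v x)
    have h2 := sq_nonneg (weakDeriv u x - speed μ (u x))
    unfold excess at hx'
    refine ⟨sub_eq_zero.1 (pow_eq_zero_iff (two_ne_zero) |>.1 ?_), ?_⟩ <;> linarith
  constructor
  · intro x
    -- The weak derivative agrees almost everywhere with a continuous function, so `u` is a
    -- primitive of that function and hence classically differentiable.
    have hu : u = fun y => u 0 + ∫ t in (0 : ℝ)..y, speed μ (u t) := by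
      ext y
      rw [← intervalIntegral.integral_congr_ae (f := weakDeriv u)
        (by filter_upwards [hae] with t ht _ using ht.1),
        ← h.memH1Loc_u.hasWeakDeriv.sub_eq_integral h.continuous_u hg]
      ring
    have := (hs.integral_hasStrictDerivAt 0 x).hasDerivAt.const_add (u 0)
    rwa [← hu] at this
  · exact congrFun (Continuous.ae_eq_iff_eq (μ := volume) (h.continuous_potential_comp μ)
      ((hs.pow 2).div_const 2) |>.1 (by filter_upwards [hae] with x hx using hx.2))

end ThomasFermi
end

/-! ### The explicit profile: sech and tanh pieces and their gluing -/

noncomputable section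

namespace ThomasFermi

/-- The two one-sided derivatives at `z` coincide. It serves both for `u₀` and for its derivative.
-/
theorem hasDerivAt_ite_le {f g f' g' : ℝ → ℝ} {z : ℝ} (hf : ∀ x, HasDerivAt f (f' x) x)
    (hg : ∀ x, HasDerivAt g (g' x) x) (h : f z = g z) (h' : f' z = g' z) (x : ℝ) :
    HasDerivAt (fun x => if x ≤ z then f x else g x) (if x ≤ z then f' x else g' x) x := by
  rcases lt_trichotomy x z with hx | rfl | hx
  · rw [if_pos hx.le]
    refine (hf x).congr_of_eventuallyEq ?_
    filter_upwards [Iio_mem_nhds hx] with y hy using if_pos (le_of_lt hy)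
  · rw [if_pos le_rfl, ← hasDerivWithinAt_univ, ← Set.Iic_union_Ici (a := x)]
    refine HasDerivWithinAt.union ?_ ?_
    · exact (hf x).hasDerivWithinAt.congr (fun y hy => if_pos hy) (if_pos le_rfl)
    · rw [h']
      refine (hg x).hasDerivWithinAt.congr (fun y hy => ?_) (by rw [if_pos le_rfl, h])
      rcases eq_or_lt_of_le (Set.mem_Ici.1 hy) with rfl | hy
      · rw [if_pos le_rfl, h]
      · exact if_neg (not_le.2 hy)
  · rw [if_neg (not_le.2 hx)]
    refine (hg x).congr_of_eventuallyEq ?_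
    filter_upwards [Ioi_mem_nhds hx] with y hy using if_neg (not_le.2 hy)

theorem hasDerivAt_tanh (x : ℝ) : HasDerivAt Real.tanh (1 - Real.tanh x ^ 2) x := by
  have hc := (Real.cosh_pos x).ne'
  have h := (Real.hasDerivAt_sinh x).div (Real.hasDerivAt_cosh x) hc
  have e : Real.tanh = fun x => Real.sinh x / Real.cosh x := funext Real.tanh_eq_sinh_div_cosh
  rw [e]
  refine h.congr_deriv ?_
  field_simp

theorem hasDerivAt_sech (x : ℝ) : HasDerivAt sech (-(sech x * Real.tanh x)) x := by
  have hc := (Real.cosh_pos x).ne'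
  have h := (Real.hasDerivAt_cosh x).inv hc
  have e : sech = fun x => (Real.cosh x)⁻¹ := funext fun x => by rw [sech, one_div]
  rw [e, Real.tanh_eq_sinh_div_cosh]
  refine h.congr_deriv ?_
  field_simp

theorem sech_pos (x : ℝ) : 0 < sech x := one_div_pos.2 (Real.cosh_pos x)

theorem tanh_sq_eq (x : ℝ) : Real.tanh x ^ 2 = 1 - sech x ^ 2 := by
  have hc := (Real.cosh_pos x).ne'
  rw [Real.tanh_eq_sinh_div_cosh, sech]
  field_simp
  linarith [Real.cosh_sq x]

theorem neg_tanh_eq_sqrt {x : ℝ} (hx : x ≤ 0) : -Real.tanh x = √(1 - sech x ^ 2) := by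
  rw [← tanh_sq_eq, Real.sqrt_sq_eq_abs, abs_of_nonpos]
  rw [Real.tanh_eq_sinh_div_cosh]
  exact div_nonpos_of_nonpos_of_nonneg (Real.sinh_nonpos_iff.2 hx) (Real.cosh_pos x).le

theorem strictMono_tanh : StrictMono Real.tanh := by
  refine strictMono_of_deriv_pos fun x => ?_
  rw [(hasDerivAt_tanh x).deriv]
  linarith [Real.tanh_sq_lt_one x]

theorem tendsto_tanh_atTop : Tendsto Real.tanh atTop (𝓝 1) := by
  have h : Tendsto (fun x : ℝ => Real.exp (-2 * x)) atTop (𝓝 0) :=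
    Real.tendsto_exp_atBot.comp (tendsto_id.const_mul_atTop_of_neg (by norm_num))
  have h2 := (h.const_sub 1).div (h.const_add 1) (by norm_num)
  simp only [sub_zero, add_zero, div_one] at h2
  refine h2.congr fun x => ?_
  -- This turns `tanh x` into `(1 - e^(-2x)) / (1 + e^(-2x))`.
  have e : Real.exp (-x) = Real.exp x * Real.exp (-2 * x) := by
    rw [← Real.exp_add]; congr 1; ring
  simp only [Pi.div_apply]
  rw [Real.tanh_eq, e]
  have := Real.exp_pos x
  have := Real.exp_pos (-2 * x)
  field_simp

theorem tendsto_sech_atBot : Tendsto sech atBot (𝓝 0) := by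
  have h : Tendsto (fun x : ℝ => 2 * Real.exp x) atBot (𝓝 0) := by
    simpa using Real.tendsto_exp_atBot.const_mul 2
  refine squeeze_zero (fun x => (sech_pos x).le) (fun x => ?_) h
  rw [sech, div_le_iff₀ (Real.cosh_pos x), Real.cosh_eq]
  have : Real.exp x * Real.exp (-x) = 1 := by rw [← Real.exp_add]; simp
  nlinarith [Real.exp_pos x]

variable {μ z x₀ : ℝ}

theorem one_lt_inv_sqrt (hμ : 1 < μ) : 1 < 1 / √((μ + 1) / (2 * μ)) := by
  have h : (μ + 1) / (2 * μ) < 1 := by rw [div_lt_one (by linarith)]; linarith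
  have h0 : 0 < √((μ + 1) / (2 * μ)) := Real.sqrt_pos.2 (by positivity)
  rw [one_lt_div h0]
  exact (Real.sqrt_lt_sqrt (by positivity) h).trans_eq Real.sqrt_one

theorem arcsech_pos (hμ : 1 < μ) : 0 < arcsech √((μ + 1) / (2 * μ)) :=
  Real.arcosh_pos (one_lt_inv_sqrt hμ)

theorem sech_arcsech (hμ : 1 < μ) :
    sech (arcsech √((μ + 1) / (2 * μ))) = √((μ + 1) / (2 * μ)) := by
  rw [sech, arcsech, Real.cosh_arcosh (one_lt_inv_sqrt hμ).le, one_div_one_div]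

/-- The phase of the sech piece. -/
def phase (μ z x : ℝ) : ℝ := √(μ - 1) * (x - x₁ μ z)

/-- The sech piece. -/
def sechPiece (μ z x : ℝ) : ℝ := √(2 / (μ + 1)) * sech (phase μ z x)

/-- The tanh piece. -/
def tanhPiece (x₀ x : ℝ) : ℝ := Real.tanh ((x - x₀) / √2)

theorem phase_self (hμ : 1 < μ) (z : ℝ) : phase μ z z = -arcsech √((μ + 1) / (2 * μ)) := by
  have : √(μ - 1) ≠ 0 := (Real.sqrt_pos.2 (by linarith)).ne'
  rw [phase, x₁]
  field_simp
  ring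

theorem strictMono_phase (hμ : 1 < μ) (z : ℝ) : StrictMono (phase μ z) := by
  intro x y hxy
  have : 0 < √(μ - 1) := Real.sqrt_pos.2 (by linarith)
  unfold phase
  gcongr

theorem phase_neg (hμ : 1 < μ) {x : ℝ} (hx : x ≤ z) : phase μ z x < 0 := by
  have h1 := (strictMono_phase hμ z).monotone hx
  rw [phase_self hμ] at h1
  linarith [arcsech_pos hμ]

theorem sechPiece_pos (hμ : 1 < μ) (z x : ℝ) : 0 < sechPiece μ z x :=
  mul_pos (Real.sqrt_pos.2 (by positivity)) (sech_pos _)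

/-- The shift in `x₁` is chosen for this: at `z` the sech piece reaches the level where the optimal
`v` vanishes. -/
theorem sechPiece_self (hμ : 1 < μ) (z : ℝ) : sechPiece μ z z = (√μ)⁻¹ := by
  have hs : sech (phase μ z z) = √((μ + 1) / (2 * μ)) := by
    refine Eq.trans ?_ (sech_arcsech hμ)
    rw [phase_self hμ, sech, sech, Real.cosh_neg]
  have : 2 / (μ + 1) * ((μ + 1) / (2 * μ)) = μ⁻¹ := by
    have : μ + 1 ≠ 0 := by positivity
    field_simp
  rw [sechPiece, hs, ← Real.sqrt_mul (by positivity), this, Real.sqrt_inv]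

theorem sechPiece_lt (hμ : 1 < μ) {x y : ℝ} (hxy : x < y) (hy : y ≤ z) :
    sechPiece μ z x < sechPiece μ z y := by
  have hA : 0 < √(2 / (μ + 1)) := Real.sqrt_pos.2 (by positivity)
  have h1 := strictMono_phase hμ z hxy
  have h2 := phase_neg hμ hy
  refine mul_lt_mul_of_pos_left ?_ hA
  refine one_div_lt_one_div_of_lt (Real.cosh_pos _) ?_
  rw [Real.cosh_lt_cosh, abs_of_neg h2, abs_of_neg (h1.trans h2)]
  linarith

theorem sechPiece_lt_inv_sqrt (hμ : 1 < μ) {x : ℝ} (hx : x < z) :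
    sechPiece μ z x < (√μ)⁻¹ := sechPiece_self hμ z ▸ sechPiece_lt hμ hx le_rfl

theorem sechPiece_le_inv_sqrt (hμ : 1 < μ) {x : ℝ} (hx : x ≤ z) :
    sechPiece μ z x ≤ (√μ)⁻¹ := by
  rcases hx.eq_or_lt with rfl | hx
  · exact (sechPiece_self hμ x).le
  · exact (sechPiece_lt_inv_sqrt hμ hx).le

theorem sech_sq_phase (hμ : 1 < μ) (z x : ℝ) :
    sech (phase μ z x) ^ 2 = (μ + 1) / 2 * sechPiece μ z x ^ 2 := by
  rw [sechPiece, mul_pow, Real.sq_sqrt (by positivity)]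
  have : μ + 1 ≠ 0 := by positivity
  field_simp

/-- The derivative of the sech piece. -/
def sechPieceDeriv (μ z x : ℝ) : ℝ :=
  √(μ - 1) * sechPiece μ z x * -Real.tanh (phase μ z x)

theorem hasDerivAt_phase (μ z x : ℝ) : HasDerivAt (phase μ z) √(μ - 1) x := by
  exact (((hasDerivAt_id x).sub_const (x₁ μ z)).const_mul √(μ - 1)).congr_deriv (mul_one _)

theorem hasDerivAt_sechPiece (μ z x : ℝ) :
    HasDerivAt (sechPiece μ z) (sechPieceDeriv μ z x) x := by
  refine (((hasDerivAt_sech _).comp x (hasDerivAt_phase μ z x)).const_mul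
    √(2 / (μ + 1))).congr_deriv ?_
  rw [sechPieceDeriv, sechPiece]
  ring

theorem hasDerivAt_sechPieceDeriv (hμ : 1 < μ) (z x : ℝ) : HasDerivAt (sechPieceDeriv μ z)
    ((μ - 1) * sechPiece μ z x * (1 - (μ + 1) * sechPiece μ z x ^ 2)) x := by
  have h := ((hasDerivAt_sechPiece μ z x).const_mul √(μ - 1)).mul
    ((hasDerivAt_tanh _).comp x (hasDerivAt_phase μ z x)).neg
  refine h.congr_deriv ?_
  have hk : √(μ - 1) ^ 2 = μ - 1 := Real.sq_sqrt (by linarith)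
  have ht := tanh_sq_eq (phase μ z x)
  rw [sech_sq_phase hμ] at ht
  simp only [sechPieceDeriv, Function.comp_apply, Pi.neg_apply]
  set s := sechPiece μ z x
  set T := Real.tanh (phase μ z x)
  have : √(μ - 1) * (√(μ - 1) * s * -T) * -T + √(μ - 1) * s * -((1 - T ^ 2) * √(μ - 1))
    = √(μ - 1) ^ 2 * (s * (2 * T ^ 2 - 1)) := by ring
  rw [this, hk, ht]
  ring

/-- Left of `z` the phase is negative, which selects the positive root `-tanh = √(1 - sech²)`. -/
theorem sechPieceDeriv_eq_speedLeft (hμ : 1 < μ) {x : ℝ} (hx : x ≤ z) :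
    sechPieceDeriv μ z x = speedLeft μ (sechPiece μ z x) := by
  rw [sechPieceDeriv, neg_tanh_eq_sqrt (phase_neg hμ hx).le, sech_sq_phase hμ, speedLeft]

theorem hasDerivAt_tanhPiece (x₀ x : ℝ) :
    HasDerivAt (tanhPiece x₀) (speedRight (tanhPiece x₀ x)) x := by
  have h := (hasDerivAt_tanh ((x - x₀) / √2)).comp x
    (((hasDerivAt_id x).sub_const x₀).div_const √2)
  refine h.congr_deriv ?_
  rw [speedRight, tanhPiece]
  ring

theorem hasDerivAt_speedRight_tanhPiece (x₀ x : ℝ) :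
    HasDerivAt (fun x => speedRight (tanhPiece x₀ x))
      (-(tanhPiece x₀ x * (1 - tanhPiece x₀ x ^ 2))) x := by
  have h := (((hasDerivAt_tanhPiece x₀ x).pow 2).const_sub 1).div_const √2
  refine h.congr_deriv ?_
  have : √2 ^ 2 = (2 : ℝ) := Real.sq_sqrt (by norm_num)
  rw [speedRight]
  field_simp
  rw [this]
  push_cast
  ring

theorem isMatching_iff (hμ : 1 < μ) : IsMatching μ z x₀ ↔ tanhPiece x₀ z = (√μ)⁻¹ := by
  rw [← sechPiece_self hμ z]; rfl

theorem existsUnique_isMatching (hμ : 1 < μ) (z : ℝ) : ∃! x₀ : ℝ, IsMatching μ z x₀ := by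
  have h2 : √2 ≠ (0 : ℝ) := by positivity
  simp only [isMatching_iff hμ]
  have hmem : (√μ)⁻¹ ∈ Set.Ioo (-1 : ℝ) 1 :=
    ⟨by linarith [inv_sqrt_pos hμ], inv_sqrt_lt_one hμ⟩
  -- The matching condition reads `tanh ((z - x₀) / √2) = 1 / √μ`, solved for `x₀`.
  refine ⟨z - √2 * Real.artanh (√μ)⁻¹, ?_, ?_⟩
  · simp only [tanhPiece]
    rw [← Real.tanh_artanh hmem, Real.artanh_tanh]
    congr 1
    field_simp
    ring
  · intro y hy
    simp only [tanhPiece] at hy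
    rw [← hy, Real.artanh_tanh]
    field_simp
    ring

theorem IsMatching.tanhPiece_self (h : IsMatching μ z x₀) (hμ : 1 < μ) :
    tanhPiece x₀ z = (√μ)⁻¹ := (isMatching_iff hμ).1 h

theorem strictMono_tanhPiece (x₀ : ℝ) : StrictMono (tanhPiece x₀) := by
  intro x y hxy
  refine strictMono_tanh ?_
  have : (0 : ℝ) < √2 := by positivity
  gcongr

theorem IsMatching.inv_sqrt_lt (h : IsMatching μ z x₀) (hμ : 1 < μ) {x : ℝ} (hx : z < x) :
    (√μ)⁻¹ < tanhPiece x₀ x := h.tanhPiece_self hμ ▸ strictMono_tanhPiece x₀ hx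

theorem u₀_of_le {x : ℝ} (hx : x ≤ z) : u₀ μ z x₀ x = sechPiece μ z x := if_pos hx

theorem u₀_of_lt {x : ℝ} (hx : z < x) : u₀ μ z x₀ x = tanhPiece x₀ x := if_neg (not_le.2 hx)

theorem IsMatching.u₀_mem_Ioo (h : IsMatching μ z x₀) (hμ : 1 < μ) (x : ℝ) :
    u₀ μ z x₀ x ∈ Set.Ioo (0 : ℝ) 1 := by
  rcases le_or_gt x z with hx | hx
  · rw [u₀_of_le hx]
    exact ⟨sechPiece_pos hμ z x, (sechPiece_le_inv_sqrt hμ hx).trans_lt (inv_sqrt_lt_one hμ)⟩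
  · rw [u₀_of_lt hx]
    exact ⟨(inv_sqrt_pos hμ).trans (h.inv_sqrt_lt hμ hx), Real.tanh_lt_one _⟩

/-- The first component solves the first-order equation. -/
theorem IsMatching.hasDerivAt_u₀ (h : IsMatching μ z x₀) (hμ : 1 < μ) (x : ℝ) :
    HasDerivAt (u₀ μ z x₀) (speed μ (u₀ μ z x₀ x)) x := by
  have hz : sechPiece μ z z = tanhPiece x₀ z := by rw [sechPiece_self hμ, h.tanhPiece_self hμ]
  refine (hasDerivAt_ite_le (hasDerivAt_sechPiece μ z) (hasDerivAt_tanhPiece x₀) hz ?_ x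
    ).congr_deriv ?_
  · rw [sechPieceDeriv_eq_speedLeft hμ le_rfl, ← hz, sechPiece_self hμ, speedLeft_inv_sqrt hμ]
  · rcases le_or_gt x z with hx | hx
    · rw [if_pos hx, sechPieceDeriv_eq_speedLeft hμ hx, u₀_of_le hx,
        speed_eq_speedLeft hμ (sechPiece_pos hμ z x).le (sechPiece_le_inv_sqrt hμ hx)]
    · rw [if_neg (not_le.2 hx), u₀_of_lt hx,
        speed_eq_speedRight hμ (h.inv_sqrt_lt hμ hx).le (Real.tanh_lt_one _).le]

theorem IsMatching.continuous_u₀ (h : IsMatching μ z x₀) (hμ : 1 < μ) :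
    Continuous (u₀ μ z x₀) :=
  continuous_iff_continuousAt.2 fun x => (h.hasDerivAt_u₀ hμ x).continuousAt

/-- Right of `z` the radicand is nonpositive and `Real.sqrt` returns zero, so one formula covers
both branches. -/
theorem IsMatching.v₀_eq_sqrt (h : IsMatching μ z x₀) (hμ : 1 < μ) (x : ℝ) :
    v₀ μ z x = √(1 - μ * u₀ μ z x₀ x ^ 2) := by
  rcases le_or_gt x z with hx | hx
  · have e := sech_sq_phase hμ z x
    have hv : v₀ μ z x = √(1 - 2 * μ / (μ + 1) * sech (phase μ z x) ^ 2) := if_pos hx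
    rw [u₀_of_le hx, hv, e]
    congr 1
    have : μ + 1 ≠ 0 := by positivity
    field_simp
  · have hv : v₀ μ z x = 0 := if_neg (not_le.2 hx)
    rw [hv, u₀_of_lt hx, Real.sqrt_eq_zero_of_nonpos]
    linarith [one_le_mul_sq_of_le hμ (h.inv_sqrt_lt hμ hx).le]

theorem v₀_nonneg (μ z x : ℝ) : 0 ≤ v₀ μ z x := by
  unfold v₀; split_ifs
  · exact Real.sqrt_nonneg _
  · exact le_rfl

theorem IsMatching.v₀_sq (h : IsMatching μ z x₀) (hμ : 1 < μ) (x : ℝ) :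
    v₀ μ z x ^ 2 = max (1 - μ * u₀ μ z x₀ x ^ 2) 0 := by
  rw [h.v₀_eq_sqrt hμ]
  rcases le_total (1 - μ * u₀ μ z x₀ x ^ 2) 0 with h0 | h0
  · rw [Real.sqrt_eq_zero_of_nonpos h0, max_eq_right h0]; norm_num
  · rw [Real.sq_sqrt h0, max_eq_left h0]

theorem IsMatching.v₀_pos (h : IsMatching μ z x₀) (hμ : 1 < μ) {x : ℝ} (hx : x < z) :
    0 < v₀ μ z x := by
  rw [h.v₀_eq_sqrt hμ, Real.sqrt_pos, u₀_of_le hx.le]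
  have h1 : sechPiece μ z x ^ 2 < 1 / μ := by
    rw [← inv_sqrt_sq hμ]
    have := sechPiece_pos hμ z x
    have := sechPiece_lt_inv_sqrt hμ hx
    gcongr
  rw [lt_div_iff₀ (by linarith)] at h1
  linarith

theorem v₀_of_le (hμ : 1 < μ) {x : ℝ} (hx : z ≤ x) : v₀ μ z x = 0 := by
  rcases hx.eq_or_lt with rfl | hx
  · obtain ⟨x₀, h, -⟩ := existsUnique_isMatching hμ z
    rw [h.v₀_eq_sqrt hμ, u₀_of_le le_rfl, sechPiece_self hμ, inv_sqrt_sq hμ,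
      mul_one_div_cancel (by positivity)]
    simp
  · exact if_neg (not_le.2 hx)

theorem IsMatching.continuous_v₀ (h : IsMatching μ z x₀) (hμ : 1 < μ) :
    Continuous (v₀ μ z) := by
  have := h.continuous_u₀ hμ
  rw [funext (h.v₀_eq_sqrt hμ)]
  fun_prop

theorem IsMatching.isSolution (h : IsMatching μ z x₀) (hμ : 1 < μ) :
    IsSolution μ (u₀ μ z x₀) (v₀ μ z) := by
  have hcu := h.continuous_u₀ hμ
  have hcv := h.continuous_v₀ hμ
  have hz : sechPiece μ z z = tanhPiece x₀ z := by rw [sechPiece_self hμ, h.tanhPiece_self hμ]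
  have hz' : sechPieceDeriv μ z z = speedRight (tanhPiece x₀ z) := by
    rw [sechPieceDeriv_eq_speedLeft hμ le_rfl, ← hz, sechPiece_self hμ, speedLeft_inv_sqrt hμ]
  have hd1 : deriv (u₀ μ z x₀) = fun x => if x ≤ z then sechPieceDeriv μ z x
      else speedRight (tanhPiece x₀ x) := funext fun x =>
    (hasDerivAt_ite_le (hasDerivAt_sechPiece μ z) (hasDerivAt_tanhPiece x₀) hz hz' x).deriv
  have hd2 : ∀ x, HasDerivAt (deriv (u₀ μ z x₀))
      (-(u₀ μ z x₀ x * (1 - u₀ μ z x₀ x ^ 2 - μ * v₀ μ z x ^ 2))) x := by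
    intro x
    rw [hd1]
    refine (hasDerivAt_ite_le (hasDerivAt_sechPieceDeriv hμ z)
      (hasDerivAt_speedRight_tanhPiece x₀) hz' ?_ x).congr_deriv ?_
    -- At the junction both second derivatives equal `-(1 / √μ) (1 - 1 / μ)`, so `u₀'` is
    -- differentiable there too.
    · rw [← hz, sechPiece_self hμ, inv_sqrt_sq hμ]
      have : μ ≠ 0 := by positivity
      field_simp
      ring
    · rcases le_or_gt x z with hx | hx
      · rw [if_pos hx, h.v₀_sq hμ, u₀_of_le hx, max_eq_left (by
          linarith [mul_sq_le_one_of_le hμ (sechPiece_pos hμ z x).le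
            (sechPiece_le_inv_sqrt hμ hx)])]
        ring
      · rw [if_neg (not_le.2 hx), v₀_of_le hμ hx.le, u₀_of_lt hx]
        ring
  refine ⟨?_, hcv, fun x => by rw [(hd2 x).deriv]; ring, fun x => ?_⟩
  · rw [show (2 : WithTop ℕ∞) = 1 + 1 by norm_num, contDiff_succ_iff_deriv]
    refine ⟨fun x => (h.hasDerivAt_u₀ hμ x).differentiableAt, by simp, ?_⟩
    rw [contDiff_one_iff_deriv]
    refine ⟨fun x => (hd2 x).differentiableAt, ?_⟩
    -- The equation expresses `u₀''` as a polynomial in the continuous functions `u₀` and `v₀`.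
    rw [funext fun x => (hd2 x).deriv]
    fun_prop
  · rcases lt_or_ge x z with hx | hx
    · rw [h.v₀_sq hμ, u₀_of_le hx.le, max_eq_left (by
          linarith [mul_sq_le_one_of_le hμ (sechPiece_pos hμ z x).le
            (sechPiece_le_inv_sqrt hμ hx.le)])]
      ring
    · rw [v₀_of_le hμ hx]; ring

theorem IsMatching.lipschitzWith_u₀ (h : IsMatching μ z x₀) (hμ : 1 < μ) :
    LipschitzWith 1 (u₀ μ z x₀) := by
  refine lipschitzWith_of_nnnorm_deriv_le (𝕜 := ℝ)
    (fun x => (h.hasDerivAt_u₀ hμ x).differentiableAt) fun x => ?_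
  rw [(h.hasDerivAt_u₀ hμ x).deriv, ← NNReal.coe_le_coe, coe_nnnorm, Real.norm_eq_abs,
    abs_of_nonneg (speed_nonneg hμ _)]
  exact speed_le_one hμ _

theorem abs_sub_sq_le_abs_sq_sub {a b : ℝ} (ha : 0 ≤ a) (hb : 0 ≤ b) :
    |a - b| ^ 2 ≤ |a ^ 2 - b ^ 2| := by
  have e : a ^ 2 - b ^ 2 = (a - b) * (a + b) := by ring
  rw [e, abs_mul, sq]
  refine mul_le_mul_of_nonneg_left ?_ (abs_nonneg _)
  rw [abs_of_nonneg (add_nonneg ha hb), abs_le]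
  constructor <;> linarith

/-- The square of `v₀` is Lipschitz: `u₀` is 1-Lipschitz with values in `(0, 1)`, so `μ u₀²` has
constant `2 μ`, and the positive part does not increase it. -/
theorem IsMatching.abs_v₀_sub_sq_le (h : IsMatching μ z x₀) (hμ : 1 < μ) (x y : ℝ) :
    |v₀ μ z x - v₀ μ z y| ^ 2 ≤ 2 * μ * |x - y| := by
  refine (abs_sub_sq_le_abs_sq_sub (v₀_nonneg μ z x) (v₀_nonneg μ z y)).trans ?_
  rw [h.v₀_sq hμ, h.v₀_sq hμ]
  refine (abs_max_sub_max_le_abs _ _ _).trans ?_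
  have hl : |u₀ μ z x₀ x - u₀ μ z x₀ y| ≤ |x - y| := by
    simpa [Real.dist_eq] using (h.lipschitzWith_u₀ hμ).dist_le_mul x y
  have hx := h.u₀_mem_Ioo hμ x
  have hy := h.u₀_mem_Ioo hμ y
  have e : 1 - μ * u₀ μ z x₀ x ^ 2 - (1 - μ * u₀ μ z x₀ y ^ 2)
    = -(μ * (u₀ μ z x₀ x + u₀ μ z x₀ y) * (u₀ μ z x₀ x - u₀ μ z x₀ y)) := by ring
  rw [e, abs_neg, abs_mul, abs_of_nonneg (mul_nonneg (by linarith) (by linarith [hx.1, hy.1]))]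
  have h2 : μ * (u₀ μ z x₀ x + u₀ μ z x₀ y) ≤ 2 * μ := by nlinarith [hx.2, hy.2]
  exact mul_le_mul h2 hl (abs_nonneg _) (by linarith)

theorem IsMatching.exists_holderWith_v₀ (h : IsMatching μ z x₀) (hμ : 1 < μ) :
    ∃ C : ℝ≥0, HolderWith C (1 / 2) (v₀ μ z) := by
  refine ⟨(√(2 * μ)).toNNReal, fun x y => ?_⟩
  have hr : ((1 / 2 : ℝ≥0) : ℝ) = 1 / 2 := by norm_num
  rw [hr, edist_dist, edist_dist, ENNReal.ofReal_rpow_of_nonneg dist_nonneg (by norm_num),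
    ← Real.sqrt_eq_rpow, ENNReal.ofNNReal_toNNReal, ← ENNReal.ofReal_mul (Real.sqrt_nonneg _),
    ← Real.sqrt_mul (by linarith)]
  refine ENNReal.ofReal_le_ofReal (Real.le_sqrt_of_sq_le ?_)
  exact h.abs_v₀_sub_sq_le hμ x y

theorem IsMatching.admissible (h : IsMatching μ z x₀) (hμ : 1 < μ) :
    Admissible (u₀ μ z x₀) (v₀ μ z) := by
  have hcu := h.continuous_u₀ hμ
  have hbot : Tendsto (u₀ μ z x₀) atBot (𝓝 0) := by
    have hk : 0 < √(μ - 1) := Real.sqrt_pos.2 (by linarith)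
    have hp : Tendsto (phase μ z) atBot atBot :=
      (tendsto_atBot_add_const_right _ (-(x₁ μ z)) tendsto_id).const_mul_atBot hk
    have := (tendsto_sech_atBot.comp hp).const_mul √(2 / (μ + 1))
    rw [mul_zero] at this
    refine this.congr' ?_
    filter_upwards [eventually_le_atBot z] with x hx using (u₀_of_le hx).symm
  have htop : Tendsto (u₀ μ z x₀) atTop (𝓝 1) := by
    have hp : Tendsto (fun x : ℝ => (x - x₀) / √2) atTop atTop :=
      (tendsto_atTop_add_const_right _ (-x₀) tendsto_id).atTop_div_const (by positivity)
    refine (tendsto_tanh_atTop.comp hp).congr' ?_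
    filter_upwards [eventually_gt_atTop z] with x hx using (u₀_of_lt hx).symm
  refine ⟨memH1Loc_of_hasDerivAt ((continuous_speed hμ).comp hcu) (h.hasDerivAt_u₀ hμ), hcu,
    h.continuous_v₀ hμ, hbot, ?_, htop, ?_⟩
  · rw [funext (h.v₀_eq_sqrt hμ)]
    simpa using (((hbot.pow 2).const_mul μ).const_sub 1).sqrt
  · refine tendsto_const_nhds.congr' ?_
    filter_upwards [eventually_ge_atTop z] with x hx using (v₀_of_le hμ hx).symm

theorem IsMatching.energy_eq_cost (h : IsMatching μ z x₀) (hμ : 1 < μ) :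
    energy μ (u₀ μ z x₀) (v₀ μ z) = ENNReal.ofReal (cost μ 1) :=
  (h.admissible hμ).energy_eq_cost hμ (h.hasDerivAt_u₀ hμ) fun x =>
    (potential_eq_speed_sq_iff hμ (h.u₀_mem_Ioo hμ x).1.le (h.u₀_mem_Ioo hμ x).2.le).2
      (h.v₀_sq hμ x)

theorem IsMatching.isMinimizer (h : IsMatching μ z x₀) (hμ : 1 < μ) :
    IsMinimizer μ (u₀ μ z x₀) (v₀ μ z) :=
  ⟨h.admissible hμ, fun _ _ h₁ => (h.energy_eq_cost hμ).trans_le (h₁.le_energy hμ)⟩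

/-! ### Translations and uniqueness of minimizers -/

theorem x₁_add (μ z c : ℝ) : x₁ μ (z + c) = x₁ μ z + c := by
  unfold x₁; ring

/-- Translates stay in the explicit family, so every result for a matching pair `(z, x₀)` applies to
them. -/
theorem u₀_sub (μ z x₀ c x : ℝ) : u₀ μ z x₀ (x - c) = u₀ μ (z + c) (x₀ + c) x := by
  simp only [u₀, x₁_add, sub_le_iff_le_add, sub_add_eq_sub_sub_swap]

theorem v₀_sub (μ z c x : ℝ) : v₀ μ z (x - c) = v₀ μ (z + c) x := by
  simp only [v₀, x₁_add, sub_le_iff_le_add, sub_add_eq_sub_sub_swap]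

theorem IsMatching.add (h : IsMatching μ z x₀) (c : ℝ) : IsMatching μ (z + c) (x₀ + c) := by
  simpa only [IsMatching, x₁_add, add_sub_add_right_eq_sub] using h

/-- A minimizer is a translate of the explicit solution. -/
theorem IsMatching.exists_translate (h : IsMatching μ z x₀) (hμ : 1 < μ) {u v : ℝ → ℝ}
    (hm : IsMinimizer μ u v) :
    ∃ c : ℝ, (∀ x, u x = u₀ μ z x₀ (x - c)) ∧ ∀ x, v x = v₀ μ z (x - c) := by
  have hA := hm.1
  obtain ⟨hd, hp⟩ := hA.hasDerivAt_of_energy_le hμ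
    ((hm.2 _ _ (h.admissible hμ)).trans_eq (h.energy_eq_cost hμ))
  -- Monotonicity and the limits at infinity confine `u` to `[0, 1]`, where the optimal `v²` is
  -- characterized.
  have hmono : Monotone u := monotone_of_deriv_nonneg (fun x => (hd x).differentiableAt)
    fun x => by rw [(hd x).deriv]; exact speed_nonneg hμ _
  have h0 : ∀ x, 0 ≤ u x := hmono.le_of_tendsto hA.u_atBot
  have h1 : ∀ x, u x ≤ 1 := hmono.ge_of_tendsto hA.u_atTop
  -- A point where `u` crosses `1 / √μ` fixes the translation: it must be the gluing point of the
  -- translate.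
  obtain ⟨y, hy⟩ : (√μ)⁻¹ ∈ Set.range u := by
    refine mem_range_of_exists_le_of_exists_ge hA.continuous_u ?_ ?_
    · exact ((hA.u_atBot.eventually (gt_mem_nhds (inv_sqrt_pos hμ))).exists).imp fun _ => le_of_lt
    · exact ((hA.u_atTop.eventually (lt_mem_nhds (inv_sqrt_lt_one hμ))).exists).imp
        fun _ => le_of_lt
  obtain ⟨K, hK⟩ := exists_lipschitzWith_speed hμ
  obtain ⟨c, rfl⟩ : ∃ c, y = z + c := ⟨y - z, by ring⟩
  have h' := h.add c
  have hu : u = u₀ μ (z + c) (x₀ + c) :=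
    ODE_solution_unique_univ (v := fun _ => speed μ) (s := fun _ => Set.univ) (t₀ := z + c)
      (fun _ => hK.lipschitzOnWith) (fun t => ⟨hd t, trivial⟩)
      (fun t => ⟨h'.hasDerivAt_u₀ hμ t, trivial⟩)
      (by rw [hy, u₀_of_le le_rfl, sechPiece_self hμ])
  have hv : ∀ x, v x ^ 2 = v₀ μ (z + c) x ^ 2 := fun x => by
    rw [h'.v₀_sq hμ, ← hu]
    exact (potential_eq_speed_sq_iff hμ (h0 x) (h1 x)).1 (hp x)
  refine ⟨c, fun x => by rw [u₀_sub, ← hu], fun x => ?_⟩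
  rw [v₀_sub]
  rcases lt_or_ge x (z + c) with hx | hx
  -- Left of the junction `v² = v₀² > 0`, so `v` has no zero there; a negative value would
  -- contradict `v → 1` at `-∞` by the intermediate value theorem.
  · have hne : ∀ t ≤ x, v t ≠ 0 := fun t ht h0 => by
      have := hv t
      have := h'.v₀_pos hμ (ht.trans_lt hx)
      rw [h0] at *
      nlinarith
    have hpos : 0 ≤ v x := by
      by_contra hneg
      obtain ⟨t, ht, htx⟩ := ((hA.v_atBot.eventually (lt_mem_nhds one_pos)).and
        (eventually_le_atBot x)).exists
      obtain ⟨s, hs, hs0⟩ := intermediate_value_Icc' htx hA.continuous_v.continuousOn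
        ⟨(not_le.1 hneg).le, ht.le⟩
      exact hne s hs.2 hs0
    exact (sq_eq_sq₀ hpos (v₀_nonneg _ _ _)).1 (hv x)
  · have := hv x
    rw [v₀_of_le hμ hx] at this ⊢
    simpa using this

end ThomasFermi
end

theorem mainTheorem3 (μ : ℝ) (hμ : 1 < μ) (z : ℝ) :
    (∃! x₀ : ℝ, ThomasFermi.IsMatching μ z x₀) ∧
    ∀ x₀ : ℝ, ThomasFermi.IsMatching μ z x₀ →
      ThomasFermi.IsSolution μ (ThomasFermi.u₀ μ z x₀) (ThomasFermi.v₀ μ z) ∧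
      (∃ K : ℝ≥0, LipschitzWith K (ThomasFermi.u₀ μ z x₀)) ∧
      (∃ C : ℝ≥0, HolderWith C (1 / 2) (ThomasFermi.v₀ μ z)) ∧
      ThomasFermi.energy μ (ThomasFermi.u₀ μ z x₀) (ThomasFermi.v₀ μ z) < ⊤ ∧
      ThomasFermi.IsMinimizer μ (ThomasFermi.u₀ μ z x₀) (ThomasFermi.v₀ μ z) ∧
      ∀ u v : ℝ → ℝ, ThomasFermi.IsMinimizer μ u v ↔
        ∃ c : ℝ, (∀ x, u x = ThomasFermi.u₀ μ z x₀ (x - c)) ∧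
          ∀ x, v x = ThomasFermi.v₀ μ z (x - c) := by
  refine ⟨ThomasFermi.existsUnique_isMatching hμ z, fun x₀ h => ⟨h.isSolution hμ,
    ⟨1, h.lipschitzWith_u₀ hμ⟩, h.exists_holderWith_v₀ hμ, ?_, h.isMinimizer hμ,
    fun u v => ⟨h.exists_translate hμ, ?_⟩⟩⟩
  · rw [h.energy_eq_cost hμ]
    exact ENNReal.ofReal_lt_top
  · rintro ⟨c, hu, hv⟩
    have hu' : u = ThomasFermi.u₀ μ (z + c) (x₀ + c) :=
      funext fun x => (hu x).trans (ThomasFermi.u₀_sub μ z x₀ c x)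
    have hv' : v = ThomasFermi.v₀ μ (z + c) :=
      funext fun x => (hv x).trans (ThomasFermi.v₀_sub μ z c x)
    rw [hu', hv']
    exact (h.add c).isMinimizer hμ
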